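/- Let $M$ be a smooth (Hausdorff) manifold of dimension $2n+1$, let $g$ be a smooth Riemannian metric on $M$ with Levi-Civita connection $\nabla$, and write $\mathfrak X_M$ for the smooth vector fields on $M$. Let $f$ and $Q$ be smooth $(1,1)$-tensor fields with $Q$ nonsingular at every point, $\xi\in\mathfrak X_M$, and $\eta$ a smooth $1$-form such that for all $X,Y$ $$f^2=-Q+\eta\otimes\xi,\quad \eta(\xi)=1,\quad g(fX,fY)=g(X,QY)-\eta(X)\,\eta(Y),\quad \eta(X)=g(\xi,X),$$ that is, $(f,Q,\xi,\eta,g)$ is a weak almost-contact metric structure. Put $hX=\frac12\big([\xi,fX]-f[\xi,X]\big)$ and $(\nabla_Xf)Y=\nabla_X(fY)-f(\nabla_XY)$, and suppose that the structure is weak quasi-contact metric, i.e. for all $X,Y\in\mathfrak X_M$ $$(\nabla_Xf)Y+(\nabla_{fX}f)fY=2\,g(X,Y)\,\xi-\eta(Y)\big(X+hX+\eta(X)\,\xi\big).$$ If in addition $$(\nabla_Xf)Y=g(X,Y)\,\xi-\eta(Y)\,X\qquad\text{for all }X,Y\in\mathfrak X_M,$$ then $Q=\mathrm{id}_{TM}$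 and $(f,\xi,\eta,g)$ is a Sasakian structure on $M$, i.e. a normal contact metric structure: it is an almost-contact metric structure (the four equations above with $Q=\mathrm{id}$), and for all $X,Y\in\mathfrak X_M$ $$d\eta(X,Y)=g(X,fY),\qquad [f,f](X,Y)+2\,d\eta(X,Y)\,\xi=0,$$ where $2\,d\eta(X,Y)=X(\eta(Y))-Y(\eta(X))-\eta([X,Y])$ and $[f,f](X,Y)=f^2[X,Y]+[fX,fY]-f[fX,Y]-f[X,fY]$. -/

import Mathlib

open Bundle NormedSpace
open scoped Manifold ContDiff

noncomputable section

namespace WeakContact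

variable {E : Type*} [NormedAddCommGroup E] [NormedSpace ℝ E]
  {H : Type*} [TopologicalSpace H] {I : ModelWithCorners ℝ E H}
  {M : Type*} [TopologicalSpace M] [ChartedSpace H M] [IsManifold I ∞ M]

/-! ### Smooth vector fields, endomorphism fields and one-forms -/

/-- `X` is a smooth vector field on `M`, i.e. an element of `𝔛_M`. -/
def IsSmoothField (X : Π x : M, TangentSpace I x) : Prop :=
  ContMDiff I (I.prod 𝓘(ℝ, E)) ∞ (fun x ↦ TotalSpace.mk' E (E := TangentSpace I) x (X x))

/-- `A` is a smooth `(1,1)`-tensor field on `M`. -/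
def IsSmoothEndo
    (A : Π x : M, TangentSpace I x →L[ℝ] TangentSpace I x) : Prop :=
  ContMDiff I (I.prod 𝓘(ℝ, E →L[ℝ] E)) ∞
    (fun x ↦ TotalSpace.mk' (E →L[ℝ] E)
      (E := fun x : M ↦ TangentSpace I x →L[ℝ] TangentSpace I x) x (A x))

/-- `α` is a smooth `1`-form on `M`. -/
def IsSmoothForm (α : Π x : M, TangentSpace I x →L[ℝ] ℝ) : Prop :=
  ContMDiff I (I.prod 𝓘(ℝ, E →L[ℝ] ℝ)) ∞
    (fun x ↦ TotalSpace.mk' (E →L[ℝ] ℝ)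
      (E := fun x : M ↦ TangentSpace I x →L[ℝ] Bundle.Trivial M ℝ x) x (α x))

/-! ### Tensors that do not involve the metric -/

/-- The vector field `A X`. -/
def app (A : Π x : M, TangentSpace I x →L[ℝ] TangentSpace I x)
    (X : Π x : M, TangentSpace I x) : Π x : M, TangentSpace I x :=
  fun x ↦ A x (X x)

/-- `h X = (1/2) (𝓛_ξ f) X = (1/2) ([ξ, f X] - f [ξ, X])`. -/
def hTensor (f : Π x : M, TangentSpace I x →L[ℝ] TangentSpace I x)
    (ξ X : Π x : M, TangentSpace I x) (x : M) : TangentSpace I x :=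
  (1 / 2 : ℝ) •
    (VectorField.mlieBracket I ξ (app f X) x - f x (VectorField.mlieBracket I ξ X x))

/-- The exterior derivative of a `1`-form, with the normalization
`2 dη(X, Y) = X(η(Y)) - Y(η(X)) - η([X, Y])`. -/
def extDeriv (η : Π x : M, TangentSpace I x →L[ℝ] ℝ)
    (X Y : Π x : M, TangentSpace I x) (x : M) : ℝ :=
  (1 / 2 : ℝ) * (mvfderiv I (fun y ↦ η y (Y y)) x (X x) - mvfderiv I (fun y ↦ η y (X y)) x (Y x)
    - η x (VectorField.mlieBracket I X Y x))

/-- The Nijenhuis torsion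
`[f, f](X, Y) = f² [X, Y] + [f X, f Y] - f [f X, Y] - f [X, f Y]`. -/
def nijenhuis (f : Π x : M, TangentSpace I x →L[ℝ] TangentSpace I x)
    (X Y : Π x : M, TangentSpace I x) (x : M) : TangentSpace I x :=
  f x (f x (VectorField.mlieBracket I X Y x)) + VectorField.mlieBracket I (app f X) (app f Y) x
    - f x (VectorField.mlieBracket I (app f X) Y x)
    - f x (VectorField.mlieBracket I X (app f Y) x)

/-- The tensor `𝒩⁽¹⁾ = [f, f] + 2 dη ⊗ ξ`. -/
def normalityTensor (f : Π x : M, TangentSpace I x →L[ℝ] TangentSpace I x)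
    (ξ : Π x : M, TangentSpace I x) (η : Π x : M, TangentSpace I x →L[ℝ] ℝ)
    (X Y : Π x : M, TangentSpace I x) (x : M) : TangentSpace I x :=
  nijenhuis f X Y x + (2 * extDeriv η X Y x) • ξ x

/-- The covariant derivative of an endomorphism field:
`(∇_X f) Y = ∇_X (f Y) - f (∇_X Y)` (Mathlib writes `∇ Y x (X x)` for `(∇_X Y)(x)`). -/
def covDerivEndo (nabla : CovariantDerivative I E (fun x : M ↦ TangentSpace I x))
    (f : Π x : M, TangentSpace I x →L[ℝ] TangentSpace I x)
    (X Y : Π x : M, TangentSpace I x) (x : M) : TangentSpace I x :=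
  nabla (app f Y) x (X x) - f x (nabla Y x (X x))

/-! ### Metric structures

The Riemannian metric `g` is the inner product on the tangent spaces. -/

variable [RiemannianBundle (fun x : M ↦ TangentSpace I x)]

/-- `nabla` is the Levi-Civita connection of the Riemannian metric: the unique covariant derivative
on the tangent bundle with `X g(Y, Z) = g(∇_X Y, Z) + g(Y, ∇_X Z)` and
`∇_X Y - ∇_Y X = [X, Y]`. -/
structure IsLeviCivita
    (nabla : CovariantDerivative I E (fun x : M ↦ TangentSpace I x)) : Prop where
  metric : ∀ X Y Z : Π x : M, TangentSpace I x,
    IsSmoothField X → IsSmoothField Y → IsSmoothField Z → ∀ x,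
    mvfderiv I (fun y ↦ (inner ℝ (Y y) (Z y) : ℝ)) x (X x)
      = inner ℝ (nabla Y x (X x)) (Z x) + inner ℝ (Y x) (nabla Z x (X x))
  torsion_free : ∀ X Y : Π x : M, TangentSpace I x, IsSmoothField X → IsSmoothField Y → ∀ x,
    nabla Y x (X x) - nabla X x (Y x) = VectorField.mlieBracket I X Y x

/-- `(f, Q, ξ, η, g)` is a weak almost-contact metric structure. -/
structure IsWeakAlmostContactMetric
    (f Q : Π x : M, TangentSpace I x →L[ℝ] TangentSpace I x)
    (ξ : Π x : M, TangentSpace I x) (η : Π x : M, TangentSpace I x →L[ℝ] ℝ) : Prop where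
  smooth_f : IsSmoothEndo f
  smooth_Q : IsSmoothEndo Q
  smooth_ξ : IsSmoothField ξ
  smooth_η : IsSmoothForm η
  nonsingular : ∀ x, Function.Bijective (Q x)
  sq_f : ∀ x (v : TangentSpace I x), f x (f x v) = -Q x v + η x v • ξ x
  η_ξ : ∀ x, η x (ξ x) = 1
  metric_f : ∀ x (v w : TangentSpace I x),
    inner ℝ (f x v) (f x w) = inner ℝ v (Q x w) - η x v * η x w
  η_eq : ∀ x (v : TangentSpace I x), η x v = inner ℝ (ξ x) v

/-- `(f, ξ, η, g)` is an almost-contact metric structure: the case `Q = id`, i.e.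
`f² = -id + η ⊗ ξ`, `η(ξ) = 1`, `g(f X, f Y) = g(X, Y) - η(X) η(Y)`, `η(X) = g(ξ, X)`. -/
def IsAlmostContactMetric
    (f : Π x : M, TangentSpace I x →L[ℝ] TangentSpace I x)
    (ξ : Π x : M, TangentSpace I x) (η : Π x : M, TangentSpace I x →L[ℝ] ℝ) : Prop :=
  IsWeakAlmostContactMetric f (fun x ↦ ContinuousLinearMap.id ℝ (TangentSpace I x)) ξ η

/-- `(f, Q, ξ, η, g)`, with Levi-Civita connection `nabla`, is a weak quasi-contact metric
structure: a weak almost-contact metric structure such that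
`(∇_X f) Y + (∇_{f X} f) f Y = 2 g(X, Y) ξ - η(Y) (X + h X + η(X) ξ)`. -/
structure IsWeakQuasiContactMetric
    (nabla : CovariantDerivative I E (fun x : M ↦ TangentSpace I x))
    (f Q : Π x : M, TangentSpace I x →L[ℝ] TangentSpace I x)
    (ξ : Π x : M, TangentSpace I x) (η : Π x : M, TangentSpace I x →L[ℝ] ℝ) : Prop
    extends IsWeakAlmostContactMetric f Q ξ η where
  quasi_contact : ∀ X Y : Π x : M, TangentSpace I x, IsSmoothField X → IsSmoothField Y → ∀ x,
    covDerivEndo nabla f X Y x + covDerivEndo nabla f (app f X) (app f Y) x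
      = (2 * inner ℝ (X x) (Y x)) • ξ x
        - η x (Y x) • (X x + hTensor f ξ X x + η x (X x) • ξ x)

/-- The Sasakian identity `(∇_X f) Y = g(X, Y) ξ - η(Y) X`. -/
def SasakianIdentity (nabla : CovariantDerivative I E (fun x : M ↦ TangentSpace I x))
    (f : Π x : M, TangentSpace I x →L[ℝ] TangentSpace I x)
    (ξ : Π x : M, TangentSpace I x) (η : Π x : M, TangentSpace I x →L[ℝ] ℝ) : Prop :=
  ∀ X Y : Π x : M, TangentSpace I x, IsSmoothField X → IsSmoothField Y → ∀ x,
    covDerivEndo nabla f X Y x = (inner ℝ (X x) (Y x) : ℝ) • ξ x - η x (Y x) • X x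

/-- `(f, ξ, η, g)` is a Sasakian structure: a normal contact metric structure, i.e. an
almost-contact metric structure with `dη = Φ`, where `Φ(X, Y) = g(X, f Y)`, and `𝒩⁽¹⁾ = 0`. -/
structure IsSasakian
    (f : Π x : M, TangentSpace I x →L[ℝ] TangentSpace I x)
    (ξ : Π x : M, TangentSpace I x) (η : Π x : M, TangentSpace I x →L[ℝ] ℝ) : Prop where
  almost_contact_metric : IsAlmostContactMetric f ξ η
  contact_metric : ∀ X Y : Π x : M, TangentSpace I x, IsSmoothField X → IsSmoothField Y → ∀ x,
    extDeriv η X Y x = inner ℝ (X x) (f x (Y x))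
  normal : ∀ X Y : Π x : M, TangentSpace I x, IsSmoothField X → IsSmoothField Y → ∀ x,
    normalityTensor f ξ η X Y x = 0

end WeakContact

end

open Bundle NormedSpace
open scoped Manifold ContDiff

noncomputable section

/-! ### Linear algebra -/

section LinearAlgebra

variable {V : Type*} [NormedAddCommGroup V] [InnerProductSpace ℝ V]

/-! The equality `Q = id` is pointwise linear algebra: inserting the Sasakian identity into the
quasi-contact identity with `Y ⊥ ξ` leaves `(g(X, QY) - g(X, Y)) ξ = η(fY) fX`
(`smul_ξ_eq_of_η_eq_zero`). Skew-symmetry of `f` forces `η ∘ f = 0` (`η_map`), so `Q` is the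
identity on `ξ⊥`, and `Qξ = ξ` because `fξ = 0`. The Sasakian identity at `Y = ξ` then yields `∇_X ξ
= -fX`. Metric compatibility and vanishing torsion turn this into `dη = Φ`, and express `[f, f]`
through `∇f` alone, which the Sasakian identity evaluates. -/

/-- An endomorphism `f` of a Euclidean space with `fᵀ f = -f²` is skew-symmetric. -/
theorem LinearMap.inner_map_left_eq_neg_of_inner_map_map [FiniteDimensional ℝ V] (f : V →ₗ[ℝ] V)
    (hf : ∀ v w, (inner ℝ (f v) (f w) : ℝ) = -inner ℝ v (f (f w))) (v w : V) :
    (inner ℝ (f v) w : ℝ) = -inner ℝ v (f w) := by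
  -- The symmetric part `S = f + fᵀ` satisfies `S f = f² + fᵀ f = 0`, hence `fᵀ S = 0` by
  -- transposition. So `S² = f S` and `S³ = S f S = 0`; a symmetric nilpotent map is zero.
  set S : V →ₗ[ℝ] V := f + LinearMap.adjoint f with hS
  have hSsymm : ∀ v w, (inner ℝ (S v) w : ℝ) = inner ℝ v (S w) := by
    intro v w
    simp only [hS, LinearMap.add_apply, inner_add_left, inner_add_right,
      LinearMap.adjoint_inner_left, LinearMap.adjoint_inner_right]
    ring
  have hSf : ∀ v, S (f v) = 0 := by
    intro v
    refine ext_inner_left ℝ fun w ↦ ?_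
    simp only [hS, LinearMap.add_apply, inner_add_right, LinearMap.adjoint_inner_right,
      inner_zero_right]
    rw [hf]
    ring
  have hfS : ∀ v, LinearMap.adjoint f (S v) = 0 := by
    intro v
    refine ext_inner_left ℝ fun w ↦ ?_
    rw [LinearMap.adjoint_inner_right, ← hSsymm, hSf, inner_zero_left, inner_zero_right]
  have hS3 : ∀ v, S (S (S v)) = 0 := by
    intro v
    have h : S (S v) = f (S v) := by
      conv_lhs => rw [hS, LinearMap.add_apply, ← hS, hfS, add_zero]
    rw [h, hSf]
  have hS2 : ∀ v, S (S v) = 0 := by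
    intro v
    rw [← inner_self_eq_zero (𝕜 := ℝ), hSsymm, hS3, inner_zero_right]
  have hS1 : S v = 0 := by
    rw [← inner_self_eq_zero (𝕜 := ℝ), hSsymm, hS2, inner_zero_right]
  have h : (inner ℝ (S v) w : ℝ) = 0 := by rw [hS1, inner_zero_left]
  simp only [hS, LinearMap.add_apply, inner_add_left, LinearMap.adjoint_inner_left] at h
  linarith

/-- A skew-symmetric endomorphism with image in the line spanned by a unit vector vanishes. -/
theorem eq_zero_of_skew_of_eq_smul {f : V → V}
    (hf : ∀ v w, (inner ℝ (f v) w : ℝ) = -inner ℝ v (f w)) {ξ : V}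
    (hξ : (inner ℝ ξ ξ : ℝ) = 1) {β : V → ℝ} (h : ∀ v, f v = β v • ξ) (v : V) : f v = 0 := by
  -- Pair `f v` with `ξ`, using skew-symmetry. At `v = ξ` this reads `β ξ = -β ξ`.
  have key : ∀ v, β v = -(β ξ * inner ℝ v ξ) := by
    intro v
    have := hf v ξ
    rwa [h v, h ξ, real_inner_smul_left, real_inner_smul_right, hξ, mul_one] at this
  have h0 : β ξ = 0 := by
    have := key ξ
    rw [hξ] at this
    linarith
  rw [h, key, h0, zero_mul, neg_zero, zero_smul]

end LinearAlgebra

namespace WeakContact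

variable {E : Type*} [NormedAddCommGroup E] [NormedSpace ℝ E]
  {H : Type*} [TopologicalSpace H] {I : ModelWithCorners ℝ E H}
  {M : Type*} [TopologicalSpace M] [ChartedSpace H M] [IsManifold I ∞ M]

/-! ### Smooth fields -/

/-- Every tangent vector is the value of a smooth vector field. -/
theorem exists_isSmoothField_eq [FiniteDimensional ℝ E] [T2Space M] (x : M)
    (v : TangentSpace I x) : ∃ X : Π x : M, TangentSpace I x, IsSmoothField X ∧ X x = v := by
  obtain ⟨s, hs, hsmooth⟩ := FiberBundle.exists_contMDiffOn_extend (k := ∞) I E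
    (V := fun x : M ↦ TangentSpace I x) v
  obtain ⟨u, hus, hu, hxu⟩ := mem_nhds_iff.1 hs
  obtain ⟨ψ, -, hψ⟩ := (SmoothBumpFunction.nhds_basis_tsupport (I := I) x).mem_iff.1
    (hu.mem_nhds hxu)
  refine ⟨(ψ : M → ℝ) • FiberBundle.extend E v, ?_, ?_⟩
  · exact ContMDiffOn.smul_section_of_tsupport ψ.contMDiff.contMDiffOn hu hψ (hsmooth.mono hus)
  · simp

theorem IsSmoothEndo.app {f : Π x : M, TangentSpace I x →L[ℝ] TangentSpace I x}
    (hf : IsSmoothEndo f) {X : Π x : M, TangentSpace I x} (hX : IsSmoothField X) :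
    IsSmoothField (app f X) :=
  ContMDiff.clm_bundle_apply hf hX

variable [RiemannianBundle (fun x : M ↦ TangentSpace I x)]
  {nabla : CovariantDerivative I E (fun x : M ↦ TangentSpace I x)}
  {f Q : Π x : M, TangentSpace I x →L[ℝ] TangentSpace I x}
  {ξ : Π x : M, TangentSpace I x} {η : Π x : M, TangentSpace I x →L[ℝ] ℝ}

namespace IsWeakAlmostContactMetric

variable (h : IsWeakAlmostContactMetric f Q ξ η)
include h

theorem inner_ξ_ξ (x : M) : (inner ℝ (ξ x) (ξ x) : ℝ) = 1 := by
  rw [← h.η_eq, h.η_ξ]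

theorem inner_map_left [FiniteDimensional ℝ E] (x : M) (v w : TangentSpace I x) :
    (inner ℝ (f x v) w : ℝ) = -inner ℝ v (f x w) := by
  have : FiniteDimensional ℝ (TangentSpace I x) := inferInstanceAs (FiniteDimensional ℝ E)
  refine LinearMap.inner_map_left_eq_neg_of_inner_map_map (f x : TangentSpace I x →ₗ[ℝ] _)
    (fun v w ↦ ?_) v w
  simp only [ContinuousLinearMap.coe_coe]
  rw [h.metric_f, h.sq_f, inner_add_right, inner_neg_right, real_inner_smul_right,
    h.η_eq x v, real_inner_comm v (ξ x)]
  ring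

end IsWeakAlmostContactMetric

namespace IsWeakQuasiContactMetric

variable [FiniteDimensional ℝ E] [T2Space M] (h : IsWeakQuasiContactMetric nabla f Q ξ η)
  (hS : SasakianIdentity nabla f ξ η)
include h hS

theorem smul_ξ_eq_of_η_eq_zero (x : M) (v w : TangentSpace I x) (hw : η x w = 0) :
    ((inner ℝ v (Q x w) : ℝ) - inner ℝ v w) • ξ x = η x (f x w) • f x v := by
  obtain ⟨X, hX, rfl⟩ := exists_isSmoothField_eq x v
  obtain ⟨Y, hY, rfl⟩ := exists_isSmoothField_eq x w
  have key := h.quasi_contact X Y hX hY x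
  rw [hS X Y hX hY, hS _ _ (h.smooth_f.app hX) (h.smooth_f.app hY)] at key
  simp only [app, hw, zero_smul, sub_zero, h.metric_f, mul_zero] at key
  rw [sub_smul, sub_eq_iff_eq_add, eq_comm, ← sub_eq_zero]
  rw [← sub_eq_zero] at key
  rw [← neg_eq_zero, ← key]
  module

/-- At `ξ` this is skewness. If `η (f w) ≠ 0` for some `w ⊥ ξ`, the previous identity can be solved
for `f v`, so the image of `f` lies in the line of `ξ`; a skew map of this kind is zero, a
contradiction. -/
theorem η_map (x : M) (v : TangentSpace I x) : η x (f x v) = 0 := by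
  have hskew := h.inner_map_left x
  have hξ := h.inner_ξ_ξ x
  have hfξ : η x (f x (ξ x)) = 0 := by
    have := hskew (ξ x) (ξ x)
    rw [real_inner_comm] at this
    rw [h.η_eq]
    linarith
  have hperp : ∀ w : TangentSpace I x, η x w = 0 → η x (f x w) = 0 := by
    intro w hw
    by_contra hne
    refine hne ?_
    rw [eq_zero_of_skew_of_eq_smul (f := f x) hskew hξ
      (β := fun v ↦ (η x (f x w))⁻¹ * ((inner ℝ v (Q x w) : ℝ) - inner ℝ v w)) (fun v ↦ ?_) w,
      map_zero]
    rw [mul_smul, h.smul_ξ_eq_of_η_eq_zero hS x v w hw, smul_smul, inv_mul_cancel₀ hne, one_smul]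
  have := hperp (v - η x v • ξ x) (by simp [h.η_ξ])
  simpa [hfξ] using this

theorem map_ξ (x : M) : f x (ξ x) = 0 := by
  rw [← inner_self_eq_zero (𝕜 := ℝ), h.inner_map_left, ← h.η_eq, h.η_map hS, neg_zero]

theorem Q_eq_id (x : M) : Q x = ContinuousLinearMap.id ℝ (TangentSpace I x) := by
  have hQξ : Q x (ξ x) = ξ x := by
    have := h.sq_f x (ξ x)
    rw [h.map_ξ hS, map_zero, h.η_ξ, one_smul, eq_comm, neg_add_eq_zero] at this
    exact this
  have hperp : ∀ w : TangentSpace I x, η x w = 0 → Q x w = w := by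
    intro w hw
    refine ext_inner_left ℝ fun v ↦ ?_
    have key := h.smul_ξ_eq_of_η_eq_zero hS x v w hw
    rw [h.η_map hS, zero_smul, smul_eq_zero] at key
    refine sub_eq_zero.1 (key.resolve_right fun h0 ↦ ?_)
    have := h.η_ξ x
    rw [h0, map_zero] at this
    exact zero_ne_one this
  ext1 v
  have := hperp (v - η x v • ξ x) (by simp [h.η_ξ])
  rw [map_sub, map_smul, hQξ, sub_left_inj] at this
  simpa using this

theorem isAlmostContactMetric : IsAlmostContactMetric f ξ η := by
  have hQ : (fun x ↦ ContinuousLinearMap.id ℝ (TangentSpace I x)) = Q :=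
    funext fun x ↦ (h.Q_eq_id hS x).symm
  rw [IsAlmostContactMetric, hQ]
  exact h.toIsWeakAlmostContactMetric

theorem nabla_ξ (hnabla : IsLeviCivita nabla) {X : Π x : M, TangentSpace I x}
    (hX : IsSmoothField X) (x : M) : nabla ξ x (X x) = -f x (X x) := by
  have hη : η x (nabla ξ x (X x)) = 0 := by
    have key := hnabla.metric X ξ ξ hX h.smooth_ξ h.smooth_ξ x
    rw [funext h.inner_ξ_ξ, mvfderiv_const, real_inner_comm, ← h.η_eq] at key
    simp only [zero_apply] at key
    linarith
  have hfξ : app f ξ = 0 := funext (h.map_ξ hS)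
  have key := hS X ξ hX h.smooth_ξ x
  rw [covDerivEndo, hfξ, CovariantDerivative.zero, h.η_ξ] at key
  -- So far `-f(∇_X ξ) = η(X) ξ - X`. Applying `f` recovers `∇_X ξ` itself, since `f² = -id` on `ξ⊥`
  -- and `∇_X ξ ⊥ ξ` as `ξ` has unit length.
  replace key := congrArg (f x) key
  simp only [Pi.zero_apply, zero_apply, zero_sub, map_neg, map_sub, map_smul,
    one_smul, h.map_ξ hS, smul_zero, h.sq_f, h.Q_eq_id hS, hη, zero_smul, add_zero,
    ContinuousLinearMap.id_apply, neg_neg] at key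
  exact key

theorem extDeriv_eq (hnabla : IsLeviCivita nabla) {X Y : Π x : M, TangentSpace I x}
    (hX : IsSmoothField X) (hY : IsSmoothField Y) (x : M) :
    extDeriv η X Y x = inner ℝ (X x) (f x (Y x)) := by
  have hη : ∀ Z : Π x : M, TangentSpace I x,
      (fun y ↦ η y (Z y)) = fun y ↦ (inner ℝ (ξ y) (Z y) : ℝ) :=
    fun Z ↦ funext fun y ↦ h.η_eq y (Z y)
  rw [extDeriv, hη, hη, hnabla.metric X ξ Y hX h.smooth_ξ hY,
    hnabla.metric Y ξ X hY h.smooth_ξ hX, ← hnabla.torsion_free X Y hX hY, map_sub, h.η_eq, h.η_eq,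
    h.nabla_ξ hS hnabla hX, h.nabla_ξ hS hnabla hY, inner_neg_left, inner_neg_left,
    h.inner_map_left, real_inner_comm (X x)]
  ring

theorem normalityTensor_eq_zero (hnabla : IsLeviCivita nabla) {X Y : Π x : M, TangentSpace I x}
    (hX : IsSmoothField X) (hY : IsSmoothField Y) (x : M) : normalityTensor f ξ η X Y x = 0 := by
  have hfX := h.smooth_f.app hX
  have hfY := h.smooth_f.app hY
  have cov : ∀ U V : Π x : M, TangentSpace I x, IsSmoothField U → IsSmoothField V →
      nabla (app f V) x (U x)
        = f x (nabla V x (U x)) + ((inner ℝ (U x) (V x) : ℝ) • ξ x - η x (V x) • U x) := by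
    intro U V hU hV
    rw [← hS U V hU hV, covDerivEndo]
    abel
  -- After expansion the derivatives of `X` and `Y` cancel, leaving `[f, f](X, Y) = (∇_{fX} f)Y -
  -- (∇_{fY} f)X - f(∇_X f)Y + f(∇_Y f)X`. By the Sasakian identity this equals `-2 g(X, fY) ξ`.
  rw [normalityTensor, nijenhuis, h.extDeriv_eq hS hnabla hX hY, ← hnabla.torsion_free _ _ hX hY,
    ← hnabla.torsion_free _ _ hfX hfY, ← hnabla.torsion_free _ _ hfX hY,
    ← hnabla.torsion_free _ _ hX hfY, cov _ _ hfX hY, cov _ _ hfY hX, cov _ _ hX hY,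
    cov _ _ hY hX]
  simp only [app, map_add, map_sub, map_smul, h.map_ξ hS, h.inner_map_left]
  rw [real_inner_comm (f x (X x)) (Y x), h.inner_map_left]
  module

end IsWeakQuasiContactMetric

end WeakContact

end

theorem theorem3p5 (n : ℕ) {M : Type*} [TopologicalSpace M] [T2Space M]
    [ChartedSpace (EuclideanSpace ℝ (Fin (2 * n + 1))) M]
    [IsManifold (𝓡 (2 * n + 1)) ∞ M]
    [RiemannianBundle (fun x : M ↦ TangentSpace (𝓡 (2 * n + 1)) x)]
    [IsContMDiffRiemannianBundle (𝓡 (2 * n + 1)) ∞ (EuclideanSpace ℝ (Fin (2 * n + 1)))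
      (fun x : M ↦ TangentSpace (𝓡 (2 * n + 1)) x)]
    (nabla : CovariantDerivative (𝓡 (2 * n + 1)) (EuclideanSpace ℝ (Fin (2 * n + 1)))
      (fun x : M ↦ TangentSpace (𝓡 (2 * n + 1)) x))
    (hnabla : WeakContact.IsLeviCivita nabla)
    (f Q : Π x : M, TangentSpace (𝓡 (2 * n + 1)) x →L[ℝ] TangentSpace (𝓡 (2 * n + 1)) x)
    (ξ : Π x : M, TangentSpace (𝓡 (2 * n + 1)) x)
    (η : Π x : M, TangentSpace (𝓡 (2 * n + 1)) x →L[ℝ] ℝ)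
    (hqcm : WeakContact.IsWeakQuasiContactMetric nabla f Q ξ η)
    (hS : WeakContact.SasakianIdentity nabla f ξ η) :
    (∀ x, Q x = ContinuousLinearMap.id ℝ (TangentSpace (𝓡 (2 * n + 1)) x)) ∧
      WeakContact.IsSasakian f ξ η := by
  exact ⟨fun x ↦ hqcm.Q_eq_id hS x, hqcm.isAlmostContactMetric hS,
    fun X Y hX hY x ↦ hqcm.extDeriv_eq hS hnabla hX hY x,
    fun X Y hX hY x ↦ hqcm.normalityTensor_eq_zero hS hnabla hX hY x⟩
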